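/- For integers $k\ge 1$ let $f(k)=\lceil k/2\rceil^{-2}$ if $k\le 6$ and $f(k)=\frac{1}{2k-1}$ if $k\ge 7$. Given graphs $G_1,\dots,G_k$ on a common vertex set (an edge may belong to several of them), a rainbow path with 3 edges consists of four distinct vertices $v_0,v_1,v_2,v_3$ and three distinct indices $c_1,c_2,c_3\in\{1,\dots,k\}$ such that $v_{j-1}v_j$ is an edge of $G_{c_j}$ for $j=1,2,3$. For every $\varepsilon>0$ there exists $n_0\in\mathbb{N}$ such that for every $n\ge n_0$, every $k\ge 1$ and all graphs $G_1,\dots,G_k$ on a common set of $n$ vertices, each having at least $(f(k)+\varepsilon)\frac{n^2}{2}$ edges, there exists a rainbow path with 3 edges. Moreover, this bound is asymptotically optimal for each $k\ge 1$: for every $k\ge1$ and every $\varepsilon>0$ there exists $n_0\in\mathbb{N}$ such that for every $n\ge n_0$ there are graphs $G_1,\dots,G_k$ on a common set of $n$ vertices, each having at least $(f(k)-\varepsilon)\frac{n^2}{2}$ edges, without a rainbow path with 3 edges. -/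

import Mathlib

universe u

/-- The density threshold `f(k)`: it is `⌈k/2⌉⁻²` for `k ≤ 6` and `1/(2k-1)` for `k ≥ 7`
(only the values at `k ≥ 1` are of interest). -/
noncomputable def rainbowThreshold (k : ℕ) : ℝ :=
  if k ≤ 6 then 1 / (⌈(k : ℝ) / 2⌉₊ : ℝ) ^ 2 else 1 / (2 * (k : ℝ) - 1)

/-- The graphs `G i` (the edges of color `i`) on the common vertex set `V` contain a rainbow path
with `l` edges: `l + 1` distinct vertices `v 0, …, v l` and pairwise distinct colors
`c 0, …, c (l - 1)` such that the `j`-th edge `v j — v (j + 1)` is an edge of the graph `G (c j)`.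
An edge may lie in several of the graphs. -/
def HasRainbowPath {V : Type u} {k : ℕ} (G : Fin k → SimpleGraph V) (l : ℕ) : Prop :=
  ∃ (v : Fin (l + 1) → V) (c : Fin l → Fin k),
    Function.Injective v ∧ Function.Injective c ∧
      ∀ j : Fin l, (G (c j)).Adj (v j.castSucc) (v j.succ)

open Finset

/-! Discarding O(n) edges of each colour `i` leaves a core `W i` of minimum degree at least 3. A
colour-`j` edge inside `W j` whose ends lie in `W i` and `W l`, with `i`, `j`, `l` distinct, extends
greedily to a rainbow path. Label each vertex by the set of colours whose cores contain it. Without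
a rainbow path, a core edge of colour `j` has an end labelled {j}, or both its ends carry the same
label {j,i}. Let `a j`, `b j i`, `c` count the vertices with label {j}, with label {j,i}, and with
at least three colours. Then colour `j` has at most a_j² + 2a_j(∑ b_ji + c) + ∑ b_ji² + O(n) ordered
adjacent pairs (`exists_color_class_sizes`).

What remains is an optimisation problem: if these quadratic forms are all at least 1, the total T =
∑ a + ½∑∑ b + c satisfies f(k)T² ≥ 1 (`one_le_threshold_mul_sq`). Sharing label {j,i} equally
between its two colours gives T ≥ √(2k-1) or T ≥ k/2 + c (`sqrt_le_or_half_card_le`). For k = 3, 5,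
7 the second bound is too weak and parity supplies the missing half: two-colour labels want to pair
up the colours, and an odd number of colours cannot be paired perfectly (`half_card_succ_le_of_odd`,
`one_le_sum_excess`). For k = 4, 6 one colour is ignored; for k ≤ 2 the assumed density exceeds 1.

Sharpness: for k ≤ 6 take ⌈k/2⌉ disjoint cliques, each carrying at most two colours. For k ≥ 7 take
2k-1 equal parts; colour `i` is a clique on its own part, joined completely to the union of k-1
common parts. -/

/-! ### Numerical inequalities for one colour and for a pair of colours. -/

theorem four_thirds_le_of_sq_sum_le {a b Q : ℝ} (ha : 0 ≤ a) (hQ : Q ≤ 3 / 5 * b)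
    (h : 1 ≤ a ^ 2 + 2 * a * b + Q) : 4 / 3 ≤ 2 * a + b := by
  by_contra! hlt
  have h1 : b ≤ 4 / 3 - 2 * a := by linarith
  have h2 : (2 * a + 3 / 5) * b ≤ (2 * a + 3 / 5) * (4 / 3 - 2 * a) := by gcongr
  -- The resulting bound -3a² + 22a/15 + 4/5 peaks at a = 11/45, where it is still below 1.
  nlinarith [sq_nonneg (a - 11 / 45)]

/-- Put u = 1-x-a. Failure means e < 2u and 2a+e < 2(1-x), so e(2a+e) < 4u(1-x), while `h` gives
e(2a+e) ≥ u(1+x+a). These conflict once 5x+a ≥ 3, which is the origin of the cutoff 3/5. -/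
theorem two_le_of_three_fifths_le {a x e Q : ℝ} (ha : 0 ≤ a) (he : 0 ≤ e) (hx : 3 / 5 ≤ x)
    (hQ : Q ≤ x ^ 2 + e ^ 2) (h : 1 ≤ a ^ 2 + 2 * a * (x + e) + Q) :
    2 ≤ 2 * a + 2 * x + e := by
  by_contra! hlt
  have hu : 0 < 1 - x - a := by linarith
  have h1 : e * (2 * a + e) ≤ (2 * (1 - x - a)) * (2 * (1 - x)) :=
    mul_le_mul (by linarith) (by linarith) (by linarith) (by linarith)
  by_cases hs : e * (2 * a + e) < (2 * (1 - x - a)) * (2 * (1 - x))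
  · nlinarith [mul_nonneg hu.le (by linarith : 0 ≤ 5 * x - 3 + a)]
  · have h2 : e * (2 * a + e) < (2 * (1 - x - a)) * (2 * (1 - x)) := by
      rcases he.eq_or_lt with rfl | he'
      · have : 0 < (1 - x - a) * (1 - x) := mul_pos hu (by linarith)
        linarith
      · exact mul_lt_mul'' (by linarith) (by linarith) he (by linarith)
    exact hs h2

theorem lower_bound_of_quadratic {a u D S G : ℝ} (ha : 0 ≤ a) (hD : 0 ≤ D)
    (hG : 2 ≤ G) (hGS : G ^ 2 * S = 8 / 5) (hS : S = a + u)
    (h : 8 / 5 * u ≤ 2 * a * D + D ^ 2) : G * u ≤ D := by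
  by_contra! hlt
  have hz : 0 < G * u := lt_of_le_of_lt hD hlt
  have h1 : D ^ 2 < (G * u) ^ 2 := by gcongr
  have h2 : a * D ≤ a * (G * u) := by gcongr
  have h3 : 0 ≤ (G * u) * a * (G - 2) := by
    have : 0 ≤ G - 2 := by linarith
    positivity
  have h4 : 8 / 5 * u = G ^ 2 * (a + u) * u := by rw [← hGS, hS]
  nlinarith

/-- For two matched colours sharing weight `y`, and sharing `w`, `w'` with the unmatched colour, `h`
is half the amount by which their joint excess falls short of w + w'. -/
theorem matched_pair_bound {a a' y w w' D D' h : ℝ} (ha : 0 ≤ a) (ha' : 0 ≤ a')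
    (hw : 0 ≤ w) (hw' : 0 ≤ w') (hy : 3 / 5 ≤ y) (hwD : w ≤ D) (hwD' : w' ≤ D')
    (h1 : 1 ≤ (a + y) ^ 2 + 2 * a * D + D ^ 2) (h2 : 1 ≤ (a' + y) ^ 2 + 2 * a' * D' + D' ^ 2)
    (hh : h = 1 - y - a - a' - (D - w) / 2 - (D' - w') / 2) (h0 : 0 ≤ h) :
    2 * h + h ^ 2 ≤ 2 * (w * w') := by
  rcases h0.eq_or_lt with h0 | hpos
  · rw [← h0]; nlinarith [mul_nonneg hw hw']
  set S := 1 - y with hS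
  have hSpos : 0 < S := by linarith
  set G := √(8 / 5 / S) with hGdef
  have hGsq : G ^ 2 = 8 / 5 / S := Real.sq_sqrt (by positivity)
  have hG : 2 ≤ G := by
    apply Real.le_sqrt_of_sq_le
    rw [le_div_iff₀ hSpos]; linarith
  have hGS : G ^ 2 * S = 8 / 5 := by rw [hGsq]; field_simp
  -- With u = S-a ≤ 2/5, 1-(a+y)² = u(2-u) ≥ 8u/5.
  have k1 : G * (S - a) ≤ D := by
    refine lower_bound_of_quadratic ha (by linarith) hG hGS (by ring) ?_
    nlinarith [mul_nonneg (by linarith : 0 ≤ S - a) (by linarith : 0 ≤ 2 / 5 - S + a)]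
  have k2 : G * (S - a') ≤ D' := by
    refine lower_bound_of_quadratic ha' (by linarith) hG hGS (by ring) ?_
    nlinarith [mul_nonneg (by linarith : 0 ≤ S - a') (by linarith : 0 ≤ 2 / 5 - S + a')]
  set e := (D - w) / 2 with he
  set e' := (D' - w') / 2 with he'
  have e0 : 0 ≤ e := by rw [he]; linarith
  have e0' : 0 ≤ e' := by rw [he']; linarith
  -- Here D = w + 2e and S - a = h + e' + a' + e; since G ≥ 2, the term G·e absorbs 2e.
  have l1 : G * (h + (e' + a')) ≤ w := by
    nlinarith [mul_nonneg e0 (by linarith : 0 ≤ G - 2)]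
  have l2 : G * (h + (e + a)) ≤ w' := by
    nlinarith [mul_nonneg e0' (by linarith : 0 ≤ G - 2)]
  have hG0 : 0 ≤ G := by linarith
  have l3 : G * (h + (e' + a')) * (G * (h + (e + a))) ≤ w * w' :=
    mul_le_mul l1 l2 (by positivity) hw
  have l4 : 8 / 5 * h ≤ G * (h + (e' + a')) * (G * (h + (e + a))) := by
    have hSe : S = h + (e' + a') + (e + a) := by rw [hh]; ring
    have hmul : S * h ≤ (h + (e' + a')) * (h + (e + a)) := by
      rw [hSe]
      linarith [mul_nonneg (add_nonneg e0' ha') (add_nonneg e0 ha)]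
    have := mul_le_mul_of_nonneg_left hmul (sq_nonneg G)
    calc 8 / 5 * h = G ^ 2 * (S * h) := by rw [← hGS]; ring
      _ ≤ _ := this
      _ = _ := by ring
  have l5 : h * h ≤ h * (2 / 5) := mul_le_mul_of_nonneg_left (by linarith) h0
  linarith [pow_two h]

/-! ### Sums of squares, matchings and involutions. -/

theorem sq_sum_sub_sum_sq_mono {ι : Type*} (s : Finset ι) {f g : ι → ℝ}
    (h0 : ∀ i ∈ s, 0 ≤ f i) (h : ∀ i ∈ s, f i ≤ g i) :
    (∑ i ∈ s, f i) ^ 2 - ∑ i ∈ s, f i ^ 2 ≤ (∑ i ∈ s, g i) ^ 2 - ∑ i ∈ s, g i ^ 2 := by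
  classical
  induction s using Finset.induction_on with
  | empty => simp
  | insert i s hi ih =>
    rw [sum_insert hi, sum_insert hi, sum_insert hi, sum_insert hi]
    have h1 := ih (fun j hj => h0 j (mem_insert_of_mem hj)) (fun j hj => h j (mem_insert_of_mem hj))
    have h2 : f i * ∑ j ∈ s, f j ≤ g i * ∑ j ∈ s, g j := by
      have hi0 := h0 i (mem_insert_self _ _)
      have hil := h i (mem_insert_self _ _)
      exact mul_le_mul hil (sum_le_sum fun j hj => h j (mem_insert_of_mem hj))
        (sum_nonneg fun j hj => h0 j (mem_insert_of_mem hj)) (hi0.trans hil)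
    nlinarith

theorem sum_sq_le_sq_add_sq {ι : Type*} [DecidableEq ι] (s : Finset ι) {f : ι → ℝ}
    (h0 : ∀ i ∈ s, 0 ≤ f i) {j : ι} (hj : j ∈ s) :
    ∑ i ∈ s, f i ^ 2 ≤ f j ^ 2 + (∑ i ∈ s, f i - f j) ^ 2 := by
  rw [← add_sum_erase s _ hj, ← add_sum_erase s f hj, add_sub_cancel_left]
  have := sq_sum_sub_sum_sq_mono (s.erase j) (f := fun _ => 0) (g := f) (fun _ _ => le_rfl)
    fun i hi => h0 i (mem_of_mem_erase hi)
  simp only [sum_const_zero, ne_eq, OfNat.ofNat_ne_zero, not_false_eq_true, zero_pow, sub_zero]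
    at this
  linarith

/-- Every function of two variables admits a maximal matching of mutually maximal pairs. -/
theorem exists_maximal_mutual_matching {K : Type*} [Fintype K] [DecidableEq K] (b : K → K → ℝ) :
    ∃ σ : K → K, Function.Involutive σ ∧ (∀ j, σ j ≠ j → ∀ i, b j i ≤ b j (σ j)) ∧
      ∀ i j, i ≠ j → σ i = i → σ j = j → ¬ ((∀ l, b i l ≤ b i j) ∧ ∀ l, b j l ≤ b j i) := by
  classical
  let P : (K → K) → Prop := fun σ =>
    Function.Involutive σ ∧ ∀ j, σ j ≠ j → ∀ i, b j i ≤ b j (σ j)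
  have hne : (univ.filter P).Nonempty :=
    ⟨id, mem_filter.2 ⟨mem_univ _, fun _ => rfl, fun _ hj => absurd rfl hj⟩⟩
  -- Take the fewest fixed points: two mutually maximal fixed points could be matched to each other.
  obtain ⟨σ, hσ, hmin⟩ :=
    exists_min_image _ (fun σ : K → K => #(univ.filter fun j => σ j = j)) hne
  obtain ⟨hinv, hmax⟩ := (mem_filter.1 hσ).2
  refine ⟨σ, hinv, hmax, fun i j hij hi hj ⟨h1, h2⟩ => ?_⟩
  let τ : K → K := fun l => if l = i then j else if l = j then i else σ l
  have hτi : τ i = j := by simp [τ]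
  have hτj : τ j = i := by simp [τ, hij.symm]
  have hτ : ∀ l, l ≠ i → l ≠ j → τ l = σ l := fun l h h' => by simp [τ, h, h']
  have hσi : ∀ l, σ l = i → l = i := fun l h => by rw [← hinv l, h, hi]
  have hσj : ∀ l, σ l = j → l = j := fun l h => by rw [← hinv l, h, hj]
  have hP : P τ := by
    refine ⟨fun l => ?_, fun l hl m => ?_⟩
    · by_cases hli : l = i
      · rw [hli, hτi, hτj]
      by_cases hlj : l = j
      · rw [hlj, hτj, hτi]
      rw [hτ l hli hlj, hτ _ (fun h => hli (hσi l h)) (fun h => hlj (hσj l h)), hinv]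
    · by_cases hli : l = i
      · rw [hli, hτi]; exact h1 m
      by_cases hlj : l = j
      · rw [hlj, hτj]; exact h2 m
      rw [hτ l hli hlj] at hl ⊢
      exact hmax l hl m
  have hle := hmin τ (mem_filter.2 ⟨mem_univ _, hP⟩)
  have hlt : #(univ.filter fun l => τ l = l) < #(univ.filter fun l => σ l = l) := by
    apply card_lt_card
    refine (ssubset_iff_of_subset fun l hl => ?_).2 ⟨i, by simp [hi], by simp [hτi, hij.symm]⟩
    simp only [mem_filter, mem_univ, true_and] at hl ⊢
    by_cases hli : l = i
    · rw [hli, hi]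
    by_cases hlj : l = j
    · rw [hlj, hj]
    rwa [hτ l hli hlj] at hl
  omega

/-- The order only serves to pick one representative of each two-element orbit. -/
theorem sum_eq_add_sum_involutive {K : Type*} [Fintype K] [LinearOrder K] {σ : K → K}
    (hσ : Function.Involutive σ) {p : K} (hp : ∀ j, σ j = j ↔ j = p) (f : K → ℝ) :
    ∑ j, f j = f p + ∑ r ∈ univ.filter (fun r => r < σ r), (f r + f (σ r)) := by
  rw [← add_sum_erase univ f (mem_univ p), sum_add_distrib,
    ← sum_filter_add_sum_filter_not (univ.erase p) (fun r => r < σ r)]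
  congr 2
  · apply sum_congr _ fun _ _ => rfl
    ext r
    simp only [mem_filter, mem_erase, mem_univ, and_true, true_and, and_iff_right_iff_imp]
    exact fun h hr => h.ne ((hp r).2 hr).symm
  · refine sum_nbij' σ σ ?_ ?_ (fun r _ => hσ r) (fun r _ => hσ r) (fun r _ => by rw [hσ r])
    · intro r hr
      simp only [mem_filter, mem_erase, mem_univ, and_true, true_and, not_lt] at hr ⊢
      rw [hσ r]
      exact hr.2.lt_of_ne fun h => hr.1 ((hp r).1 h)
    · intro r hr
      simp only [mem_filter, mem_erase, mem_univ, and_true, true_and, not_lt] at hr ⊢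
      rw [hσ r]
      refine ⟨fun h => ?_, hr.le⟩
      have h' := (hp (σ r)).2 h
      rw [hσ r] at h'
      exact hr.ne h'

theorem odd_card_fixed_of_involutive {K : Type*} [Fintype K] [DecidableEq K] {σ : K → K}
    (hσ : Function.Involutive σ) (hK : Odd (Fintype.card K)) :
    Odd #(univ.filter fun j => σ j = j) := by
  have h := Equiv.Perm.card_fixedPoints_modEq (α := K) (f := (σ : Function.End K)) (p := 2) (n := 1)
    ((pow_two (M := Function.End K) σ).trans (funext hσ))
  rw [Nat.odd_iff] at hK ⊢
  have h2 : Fintype.card (Function.fixedPoints σ) = #(univ.filter fun j => σ j = j) := by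
    rw [← Set.toFinset_card]
    congr 1
    ext j
    simp [Function.IsFixedPt]
  rw [← h2, ← hK]
  exact h.symm

/-! ### The optimisation problem on weights. -/

/-- Every excess `φ j` is nonnegative, and is at least 1/3 when all `b j i` are at most 3/5, so
three such colours suffice. Otherwise, match colours that are each other's heaviest partner; by
parity some colour `p` stays unmatched, and the missing excess is found around `p`. -/
theorem one_le_sum_excess {K : Type*} [Fintype K] [LinearOrder K] {a : K → ℝ} {b : K → K → ℝ}
    (ha : ∀ j, 0 ≤ a j) (hb : ∀ i j, 0 ≤ b i j) (hsymm : ∀ i j, b i j = b j i)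
    (hdiag : ∀ j, b j j = 0) (hK : Odd (Fintype.card K))
    (h : ∀ j, 1 ≤ a j ^ 2 + 2 * a j * ∑ i, b j i + ∑ i, b j i ^ 2) :
    1 ≤ ∑ j, (2 * a j + ∑ i, b j i - 1) := by
  classical
  set β : K → ℝ := fun j => ∑ i, b j i with hβ
  set φ : K → ℝ := fun j => 2 * a j + β j - 1 with hφ
  have hβ0 : ∀ j, 0 ≤ β j := fun j => sum_nonneg fun i _ => hb j i
  have hQ : ∀ j i, ∑ i, b j i ^ 2 ≤ b j i ^ 2 + (β j - b j i) ^ 2 := fun j i =>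
    sum_sq_le_sq_add_sq univ (fun i _ => hb j i) (mem_univ i)
  have hle : ∀ j i, b j i ≤ β j := fun j i => single_le_sum (fun i _ => hb j i) (mem_univ i)
  have hle2 : ∀ j i l, i ≠ l → b j i + b j l ≤ β j := fun j i l hil => by
    rw [← sum_pair hil]
    exact sum_le_sum_of_subset_of_nonneg (subset_univ _) fun i _ _ => hb j i
  have hab : ∀ j, 1 ≤ a j + β j := by
    intro j
    have h1 := h j
    have h2 := hQ j j
    rw [hdiag] at h2
    nlinarith [ha j, hβ0 j]
  have φ0 : ∀ j, 0 ≤ φ j := fun j => by have := hab j; have := ha j; simp only [hφ]; linarith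
  have φx : ∀ j i, 3 / 5 ≤ b j i → 1 - b j i ≤ φ j := by
    intro j i hi
    have := two_le_of_three_fifths_le (ha j) (sub_nonneg.2 (hle j i)) hi (hQ j i)
      (by rw [add_sub_cancel]; exact h j)
    simp only [hφ]; linarith
  have φlow : ∀ j, (∀ i, b j i ≤ 3 / 5) → 1 / 3 ≤ φ j := by
    intro j hj
    have h1 : ∑ i, b j i ^ 2 ≤ 3 / 5 * β j := by
      rw [hβ, mul_sum]
      exact sum_le_sum fun i _ => by rw [pow_two]; exact mul_le_mul_of_nonneg_right (hj i) (hb j i)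
    have := four_thirds_le_of_sq_sum_le (ha j) h1 (h j)
    simp only [hφ]; linarith
  have hthree : ∀ s : Finset K, 3 ≤ #s → (∀ j ∈ s, ∀ i, b j i ≤ 3 / 5) → 1 ≤ ∑ j, φ j := by
    intro s hs hlow
    calc (1 : ℝ) ≤ #s * (1 / 3 : ℝ) := by
          have : (3 : ℝ) ≤ #s := by exact_mod_cast hs
          linarith
      _ = ∑ j ∈ s, (1 / 3 : ℝ) := by rw [sum_const, nsmul_eq_mul]
      _ ≤ ∑ j ∈ s, φ j := sum_le_sum fun j hj => φlow j (hlow j hj)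
      _ ≤ ∑ j, φ j := sum_le_sum_of_subset_of_nonneg (subset_univ _) fun j _ _ => φ0 j
  obtain ⟨σ, hσ, hmax, hnone⟩ := exists_maximal_mutual_matching b
  have hUodd := odd_card_fixed_of_involutive hσ hK
  set U := univ.filter fun j => σ j = j with hU
  have hUne : U.Nonempty := card_pos.1 hUodd.pos
  have hμ : ∀ j, ∃ o, ∀ i, b j i ≤ b j o := fun j => by
    obtain ⟨o, _, ho⟩ := exists_max_image univ (b j) ⟨j, mem_univ j⟩
    exact ⟨o, fun i => ho i (mem_univ i)⟩
  choose μ hμ using hμ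
  obtain ⟨p, hpU, hp⟩ := exists_max_image U (fun j => b j (μ j)) hUne
  have hσp : σ p = p := (mem_filter.1 hpU).2
  rcases le_or_gt (3 / 5) (b p (μ p)) with hx | hx
  -- The partner `o` must be matched, else `p` and `o` would be mutually maximal. Then `p`, `o`, `σ
  -- o` have total excess at least (1-b_po) + (b_po+b_oσo-1) + (1-b_oσo) = 1.
  · set o := μ p with ho
    have hop : o ≠ p := fun e => by rw [e, hdiag] at hx; norm_num at hx
    have hσo : σ o ≠ o := by
      intro hσo
      refine hnone p o hop.symm hσp hσo ⟨hμ p, fun l => ?_⟩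
      rw [hsymm o p]
      exact (hμ o l).trans (hp o (mem_filter.2 ⟨mem_univ _, hσo⟩))
    have hqp : σ o ≠ p := fun e => hop (by rw [← hσ o, e, hσp])
    have hy : b p o ≤ b o (σ o) := by rw [hsymm p o]; exact hmax o hσo p
    have h1 := φx p o hx
    have h2 := φx (σ o) o (by rw [hsymm]; exact hx.trans hy)
    have h3 := hle2 o p (σ o) hqp.symm
    have h4 : φ p + (φ o + φ (σ o)) ≤ ∑ j, φ j := by
      rw [← sum_pair hσo.symm, ← sum_insert (by simp [hop.symm, hqp.symm])]
      exact sum_le_sum_of_subset_of_nonneg (subset_univ _) fun j _ _ => φ0 j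
    have h5 : β o - 1 ≤ φ o := by simp only [hφ]; linarith [ha o]
    rw [hsymm (σ o) o] at h2
    rw [hsymm o p] at h3
    linarith
  have hUlow : ∀ j ∈ U, ∀ i, b j i ≤ 3 / 5 := fun j hj i =>
    (hμ j i).trans ((hp j hj).trans hx.le)
  by_cases hU3 : 3 ≤ #U
  · exact hthree U hU3 hUlow
  have hU1 : #U = 1 := by obtain ⟨t, ht⟩ := hUodd; omega
  have hfix : ∀ j, σ j = j ↔ j = p := by
    obtain ⟨p', hp'⟩ := card_eq_one.1 hU1
    have hpp : p = p' := by rw [hp'] at hpU; exact mem_singleton.1 hpU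
    intro j
    have hmem : j ∈ U ↔ j = p' := by rw [hp', mem_singleton]
    rw [hpp, ← hmem, hU, mem_filter, and_iff_right (mem_univ j)]
  have hsum := fun f : K → ℝ => sum_eq_add_sum_involutive hσ hfix f
  set R := univ.filter fun r => r < σ r with hR
  have hrp : ∀ r ∈ R, r ≠ p ∧ σ r ≠ p ∧ σ r ≠ r := by
    intro r hr
    have h1 : r < σ r := (mem_filter.1 hr).2
    refine ⟨fun e => h1.ne' ((hfix r).2 e), fun e => h1.ne ?_, h1.ne'⟩
    have := (hfix _).2 e
    rwa [hσ] at this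
  by_cases hlow : ∃ r ∈ R, b r (σ r) < 3 / 5
  · obtain ⟨r, hr, hlt⟩ := hlow
    obtain ⟨h1, h2, h3⟩ := hrp r hr
    refine hthree {p, r, σ r} ?_ ?_
    · rw [card_insert_of_notMem (by simp [h1.symm, h2.symm]), card_pair h3.symm]
    · intro j hj
      rw [mem_insert, mem_insert, mem_singleton] at hj
      rcases hj with rfl | rfl | rfl
      · exact hUlow _ hpU
      · exact fun i => (hmax _ h3 i).trans hlt.le
      · intro i
        have := hmax (σ r) (by rw [hσ]; exact h3.symm) i
        rw [hσ, hsymm (σ r) r] at this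
        exact this.trans hlt.le
  push Not at hlow
  -- Now `p` is the only unmatched colour and every matched pair shares at least 3/5. `H r` measures
  -- how far the excess of a pair falls short of `s r`; the shortfalls are repaid by the cross terms
  -- missing from the quadratic form of `p`.
  set s : K → ℝ := fun r => b p r + b p (σ r) with hs
  set H : K → ℝ := fun r => max 0 ((s r - φ r - φ (σ r)) / 2) with hH
  have hH0 : ∀ r, 0 ≤ H r := fun r => le_max_left _ _
  have hHle : ∀ r, s r - 2 * H r ≤ φ r + φ (σ r) := fun r => by
    have := le_max_right 0 ((s r - φ r - φ (σ r)) / 2)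
    simp only [hH]; linarith
  have hs0 : ∀ r, 0 ≤ s r := fun r => add_nonneg (hb _ _) (hb _ _)
  have hHs : ∀ r, H r ≤ s r := fun r => by
    apply max_le (hs0 r)
    have := φ0 r; have := φ0 (σ r); have := hs0 r
    linarith
  have hpair : ∀ r ∈ R, 2 * H r + H r ^ 2 ≤ 2 * (b p r * b p (σ r)) := by
    intro r hr
    obtain ⟨h1, h2, h3⟩ := hrp r hr
    have hw := hb p r
    have hw' := hb p (σ r)
    rcases max_choice 0 ((s r - φ r - φ (σ r)) / 2) with hc | hc
    · have : H r = 0 := hc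
      rw [this]; nlinarith [mul_nonneg hw hw']
    have hD := hle2 r p (σ r) h2.symm
    have hD' := hle2 (σ r) p r h1.symm
    have q1 := hQ r (σ r)
    have q2 := hQ (σ r) r
    have e1 := h r
    have e2 := h (σ r)
    rw [hsymm r p] at hD
    rw [hsymm (σ r) p, hsymm (σ r) r] at hD'
    rw [hsymm (σ r) r] at q2
    refine matched_pair_bound (a := a r) (a' := a (σ r)) (y := b r (σ r)) (D := β r - b r (σ r))
      (D' := β (σ r) - b r (σ r)) (ha _) (ha _) hw hw' (hlow r hr) (by linarith) (by linarith)
      ?_ ?_ ?_ (hH0 r)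
    · linarith
    · linarith
    · have : H r = (s r - φ r - φ (σ r)) / 2 := hc
      rw [this]; simp only [hs, hφ]; ring
  have hβp : β p = ∑ r ∈ R, s r := by
    have := hsum (b p)
    rw [hdiag, zero_add] at this
    exact this
  have hQp : ∑ i, b p i ^ 2 = ∑ r ∈ R, (b p r ^ 2 + b p (σ r) ^ 2) := by
    rw [hsum fun i => b p i ^ 2, hdiag]; ring
  have hcross := sq_sum_sub_sum_sq_mono R (fun r _ => hH0 r) (fun r _ => hHs r)
  have hpairs : ∑ r ∈ R, (2 * H r + H r ^ 2) ≤
      ∑ r ∈ R, (s r ^ 2 - (b p r ^ 2 + b p (σ r) ^ 2)) :=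
    sum_le_sum fun r hr => (hpair r hr).trans (by simp only [hs]; apply le_of_eq; ring)
  rw [sum_add_distrib, ← mul_sum, sum_sub_distrib, ← hQp] at hpairs
  rw [← hβp] at hcross
  -- Cross terms between pairs dominate those of (∑ H)², and cross terms inside a pair dominate 2H +
  -- H².
  have hsq : (1 + ∑ r ∈ R, H r) ^ 2 ≤ (a p + β p) ^ 2 := by
    have := h p
    nlinarith
  have hfin : 1 + ∑ r ∈ R, H r ≤ a p + β p :=
    le_of_sq_le_sq hsq (add_nonneg (ha p) (hβ0 p))
  have hS : ∑ r ∈ R, (s r - 2 * H r) ≤ ∑ r ∈ R, (φ r + φ (σ r)) :=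
    sum_le_sum fun r _ => hHle r
  rw [sum_sub_distrib, ← mul_sum, ← hβp] at hS
  rw [hsum φ]
  have : φ p = 2 * a p + β p - 1 := rfl
  linarith

/-- For fixed p = a + b/2 the form is at most (2p-a)² + 2ac, convex in `a`; so it lies below the
chord from 4p² at a = 0 to p² + 2pc at a = p. -/
theorem one_half_le_or_one_le {a b c Q : ℝ} (ha : 0 ≤ a) (hb : 0 ≤ b) (hQ : Q ≤ b ^ 2)
    (h : 1 ≤ a ^ 2 + 2 * a * (b + c) + Q) :
    1 / 2 ≤ a + b / 2 ∨ 1 ≤ (a + b / 2) ^ 2 + 2 * (a + b / 2) * c := by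
  by_contra! hcon
  obtain ⟨h1, h2⟩ := hcon
  set p := a + b / 2 with hp
  have hap : a ≤ p := by linarith
  have hp0 : 0 ≤ p := ha.trans hap
  have hb' : b = 2 * (p - a) := by linarith
  have h3 : 1 ≤ (2 * p - a) ^ 2 + 2 * a * c := by
    have : a + b = 2 * p - a := by linarith
    rw [← this]; linarith
  rcases hp0.eq_or_lt with h0 | h0
  · rw [← h0] at h2 hap h3
    have : a = 0 := le_antisymm hap ha
    rw [this] at h3; norm_num at h3
  have h4 : 4 * p ^ 2 < 1 := by nlinarith
  have h5 : p ≤ (p - a) * (4 * p ^ 2) + a * (p ^ 2 + 2 * p * c) := by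
    nlinarith [mul_nonneg (mul_nonneg hp0 ha) (sub_nonneg.2 hap)]
  have h6 : (p - a) * (4 * p ^ 2) ≤ (p - a) * 1 :=
    mul_le_mul_of_nonneg_left h4.le (sub_nonneg.2 hap)
  rcases ha.eq_or_lt with ha0 | ha0
  · rw [← ha0] at h5; nlinarith
  · have h7 : a * (p ^ 2 + 2 * p * c) < a * 1 := mul_lt_mul_of_pos_left h2 ha0
    linarith

section
variable {K : Type*} [Fintype K] {a : K → ℝ} {b : K → K → ℝ} {c : ℝ}

/-- If the least share p is below 1/2, then c ≥ (1-p²)/(2p), so the total is at least (k-1/2)p +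
1/(2p), and AM-GM applies. -/
theorem sqrt_le_or_half_card_le (ha : ∀ j, 0 ≤ a j) (hb : ∀ i j, 0 ≤ b i j) (hc : 0 ≤ c)
    (hK : 1 ≤ Fintype.card K)
    (h : ∀ j, 1 ≤ a j ^ 2 + 2 * a j * (∑ i, b j i + c) + ∑ i, b j i ^ 2) :
    √(2 * Fintype.card K - 1) ≤ ∑ j, a j + (∑ j, ∑ i, b j i) / 2 + c ∨
      Fintype.card K / 2 + c ≤ ∑ j, a j + (∑ j, ∑ i, b j i) / 2 + c := by
  have hK' : (1 : ℝ) ≤ Fintype.card K := by exact_mod_cast hK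
  set p : K → ℝ := fun j => a j + (∑ i, b j i) / 2 with hp
  have hsum : ∑ j, a j + (∑ j, ∑ i, b j i) / 2 = ∑ j, p j := by
    rw [hp, sum_add_distrib, sum_div]
  have hp0 : ∀ j, 0 ≤ p j := fun j =>
    add_nonneg (ha j) (div_nonneg (sum_nonneg fun i _ => hb j i) two_pos.le)
  have hor : ∀ j, 1 / 2 ≤ p j ∨ 1 ≤ p j ^ 2 + 2 * p j * c := fun j => by
    refine one_half_le_or_one_le (ha j) (sum_nonneg fun i _ => hb j i) ?_ (h j)
    have := sq_sum_sub_sum_sq_mono univ (f := fun _ : K => 0) (g := b j) (fun _ _ => le_rfl)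
      fun i _ => hb j i
    simp only [sum_const_zero, ne_eq, OfNat.ofNat_ne_zero, not_false_eq_true, zero_pow, sub_zero]
      at this
    linarith
  rw [hsum]
  by_cases hall : ∀ j, 1 / 2 ≤ p j
  · right
    have : ∑ _j : K, (1 / 2 : ℝ) ≤ ∑ j, p j := sum_le_sum fun j _ => hall j
    rw [sum_const, card_univ, nsmul_eq_mul] at this
    linarith
  left
  push Not at hall
  obtain ⟨j₀, hj₀⟩ := hall
  obtain ⟨l, -, hl⟩ := exists_min_image univ p ⟨j₀, mem_univ j₀⟩
  have hlt : p l < 1 / 2 := (hl j₀ (mem_univ _)).trans_lt hj₀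
  have h1 : 1 ≤ p l ^ 2 + 2 * p l * c := (hor l).resolve_left hlt.not_ge
  have hpos : 0 < p l := by
    rcases (hp0 l).eq_or_lt with h0 | h0
    · rw [← h0] at h1; norm_num at h1
    · exact h0
  have h2 : Fintype.card K * p l ≤ ∑ j, p j := by
    rw [← nsmul_eq_mul, ← card_univ, ← sum_const]
    exact sum_le_sum fun j hj => hl j hj
  have h3 : (1 - p l ^ 2) / (2 * p l) ≤ c := by rw [div_le_iff₀ (by positivity)]; linarith
  apply Real.sqrt_le_iff.2
  refine ⟨add_nonneg (sum_nonneg fun j _ => hp0 j) hc, ?_⟩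
  have h4 : (Fintype.card K - 1 / 2) * p l + 1 / (2 * p l) ≤ ∑ j, p j + c := by
    have : (1 - p l ^ 2) / (2 * p l) = 1 / (2 * p l) - p l / 2 := by field_simp
    linarith
  have h5 : 2 * (Fintype.card K : ℝ) - 1 ≤
      ((Fintype.card K - 1 / 2) * p l + 1 / (2 * p l)) ^ 2 := by
    have := four_mul_le_sq_add ((Fintype.card K - 1 / 2) * p l) (1 / (2 * p l))
    have e : 4 * ((Fintype.card K - 1 / 2) * p l) * (1 / (2 * p l)) =
        2 * (Fintype.card K : ℝ) - 1 := by field_simp; ring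
    linarith
  refine h5.trans (pow_le_pow_left₀ ?_ h4 2)
  have : 0 ≤ (Fintype.card K : ℝ) - 1 / 2 := by linarith
  positivity

/-- The split is by the size of A = ∑ a. Only for A < 1-c is parity needed, and there `c` can be
absorbed into the `a j`. -/
theorem half_card_succ_le_of_odd [LinearOrder K] (ha : ∀ j, 0 ≤ a j) (hb : ∀ i j, 0 ≤ b i j)
    (hsymm : ∀ i j, b i j = b j i) (hdiag : ∀ j, b j j = 0) (hK : Odd (Fintype.card K))
    (hc : 0 ≤ c) (hc2 : c ≤ 1 / 2)
    (h : ∀ j, 1 ≤ a j ^ 2 + 2 * a j * (∑ i, b j i + c) + ∑ i, b j i ^ 2) :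
    ((Fintype.card K : ℝ) + 1) / 2 ≤ ∑ j, a j + (∑ j, ∑ i, b j i) / 2 + c := by
  set β : K → ℝ := fun j => ∑ i, b j i with hβ
  set A := ∑ j, a j with hA
  have hβ0 : ∀ j, 0 ≤ β j := fun j => sum_nonneg fun i _ => hb j i
  have hQ : ∀ j, ∑ i, b j i ^ 2 ≤ β j ^ 2 := fun j => by
    have := sq_sum_sub_sum_sq_mono univ (f := fun _ : K => 0) (g := b j) (fun _ _ => le_rfl)
      fun i _ => hb j i
    simp only [sum_const_zero, ne_eq, OfNat.ofNat_ne_zero, not_false_eq_true, zero_pow, sub_zero]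
      at this
    linarith
  have hA0 : 0 ≤ A := sum_nonneg fun j _ => ha j
  have hsq : ∀ j, 1 - 2 * c * a j ≤ (a j + β j) ^ 2 := fun j => by
    have := h j; have := hQ j
    simp only [hβ] at *
    linarith
  have hsum : ∑ j, (a j + β j) = A + ∑ j, β j := sum_add_distrib
  have hone : ∑ _j : K, (1 : ℝ) = Fintype.card K := by simp
  rcases le_or_gt 1 A with hA1 | hA1
  · have h1 : ∀ j, 1 + a j * (1 - 2 * c) ≤ a j + (a j + β j) := by
      intro j
      rcases le_or_gt (a j) 1 with h1 | h1
      · have h2 : 1 - 2 * c * a j ≤ a j + β j := by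
          by_cases hneg : 1 - 2 * c * a j ≤ 0
          · exact hneg.trans (add_nonneg (ha j) (hβ0 j))
          push Not at hneg
          apply le_of_sq_le_sq _ (add_nonneg (ha j) (hβ0 j))
          refine le_trans ?_ (hsq j)
          have h3 : 0 ≤ 2 * c * a j := mul_nonneg (by linarith) (ha j)
          nlinarith
        linarith
      · nlinarith [hβ0 j, mul_nonneg hc (ha j)]
    have h2 := sum_le_sum fun j (_ : j ∈ univ) => h1 j
    rw [sum_add_distrib, hone, ← sum_mul, sum_add_distrib, hsum, ← hA] at h2
    nlinarith [mul_nonneg (sub_nonneg.2 hA1) (by linarith : 0 ≤ 1 - 2 * c)]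
  rcases le_or_gt (1 - c) A with hA2 | hA2
  · have hApos : 0 < A := by linarith
    set r := √(1 - 2 * c * A) with hr
    have hcA : c * A ≤ 1 / 2 * 1 := mul_le_mul hc2 hA1.le hA0 (by norm_num)
    have hr2 : r ^ 2 = 1 - 2 * c * A := Real.sq_sqrt (by linarith)
    have hr0 : 0 ≤ r := Real.sqrt_nonneg _
    have hr1 : r ≤ 1 := Real.sqrt_le_one.2 (by nlinarith [mul_nonneg hc hA0])
    -- The concave function √(1-2cx) lies above its chord on [0, A].
    have h1 : ∀ j, 1 - (1 - r) * (a j / A) ≤ a j + β j := by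
      intro j
      have hl0 : 0 ≤ a j / A := div_nonneg (ha j) hA0
      have hl1 : a j / A ≤ 1 :=
        (div_le_one hApos).2 (single_le_sum (fun i _ => ha i) (mem_univ j))
      have haj : a j = a j / A * A := by field_simp
      apply le_of_sq_le_sq _ (add_nonneg (ha j) (hβ0 j))
      refine le_trans ?_ (hsq j)
      have e : 2 * c * a j = (1 - r ^ 2) * (a j / A) := by
        rw [hr2]; nth_rewrite 1 [haj]; ring
      rw [e]
      nlinarith [mul_nonneg (mul_nonneg hl0 (sub_nonneg.2 hr1))
        (mul_nonneg (sub_nonneg.2 hr1) (sub_nonneg.2 hl1))]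
    have h2 := sum_le_sum fun j (_ : j ∈ univ) => h1 j
    rw [sum_sub_distrib, hone, ← mul_sum, ← sum_div, ← hA, div_self hApos.ne', hsum] at h2
    have h3 : 2 - A - 2 * c ≤ r := by
      apply le_of_sq_le_sq _ hr0
      rw [hr2]
      nlinarith [mul_nonneg (by linarith : 0 ≤ A + c - 1) (by linarith : 0 ≤ 1 - 2 * c),
        mul_nonneg (by linarith : 0 ≤ 1 - A) (by linarith : 0 ≤ A + 2 * c - 1)]
    linarith
  -- Distributing `c` in proportion to `a j` loses nothing because a_j + β_j ≥ 1-c > A.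
  have hscale : ∃ a' : K → ℝ, (∀ j, 0 ≤ a' j) ∧ ∑ j, a' j ≤ A + c ∧
      ∀ j, 1 ≤ a' j ^ 2 + 2 * a' j * ∑ i, b j i + ∑ i, b j i ^ 2 := by
    rcases hA0.eq_or_lt with hAz | hApos
    · refine ⟨a, ha, by linarith, fun j => ?_⟩
      have haj : a j = 0 := (sum_eq_zero_iff_of_nonneg fun i _ => ha i).1 hAz.symm j (mem_univ j)
      have := h j
      rw [haj] at this ⊢
      linarith
    · refine ⟨fun j => a j * (1 + c / A), fun j => mul_nonneg (ha j) (by positivity), ?_,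
        fun j => ?_⟩
      · rw [← sum_mul, ← hA]
        apply le_of_eq; field_simp
      · have h1 : 1 - c ≤ a j + β j := by
          have : 1 ≤ a j + β j + c := by
            have h1 := h j
            have h2 := hQ j
            by_contra! hlt
            have h3 : 0 ≤ a j + β j + c := by linarith [ha j, hβ0 j]
            have h4 : (a j + β j + c) ^ 2 < 1 := by nlinarith
            have h5 : 0 ≤ c * β j := mul_nonneg hc (hβ0 j)
            simp only [hβ] at *
            nlinarith [sq_nonneg c]
          linarith
        have h2 : a j * c ≤ a j * c * ((a j + β j) / A) := by
          have h3 : 1 ≤ (a j + β j) / A := (one_le_div hApos).2 (by linarith)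
          have := mul_le_mul_of_nonneg_left h3 (mul_nonneg (ha j) hc)
          linarith
        have h3 : 0 ≤ (a j * (c / A)) ^ 2 := sq_nonneg _
        have h4 := h j
        have e : a j * c * ((a j + β j) / A) = a j * (c / A) * (a j + β j) := by ring
        simp only [hβ] at *
        nlinarith
  obtain ⟨a', ha', hsum', h'⟩ := hscale
  have := one_le_sum_excess ha' hb hsymm hdiag hK h'
  rw [sum_sub_distrib, sum_add_distrib, ← mul_sum, hone] at this
  linarith
end

/-- The reciprocal square root of the rainbow threshold bounds the total weight from below. -/
theorem one_le_threshold_mul_sq {k : ℕ} (hk : k = 3 ∨ k = 5 ∨ 7 ≤ k)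
    {a : Fin k → ℝ} {b : Fin k → Fin k → ℝ} {c : ℝ}
    (ha : ∀ j, 0 ≤ a j) (hb : ∀ i j, 0 ≤ b i j)
    (hsymm : ∀ i j, b i j = b j i) (hdiag : ∀ j, b j j = 0) (hc : 0 ≤ c)
    (h : ∀ j, 1 ≤ a j ^ 2 + 2 * a j * (∑ i, b j i + c) + ∑ i, b j i ^ 2) :
    1 ≤ rainbowThreshold k * (∑ j, a j + (∑ j, ∑ i, b j i) / 2 + c) ^ 2 := by
  have hk3 : (3 : ℝ) ≤ k := by exact_mod_cast (by omega : 3 ≤ k)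
  set T := ∑ j, a j + (∑ j, ∑ i, b j i) / 2 + c with hT
  have hT0 : 0 ≤ T := by
    have h1 : 0 ≤ ∑ j, a j := sum_nonneg fun j _ => ha j
    have h2 : 0 ≤ ∑ j, ∑ i, b j i := sum_nonneg fun j _ => sum_nonneg fun i _ => hb j i
    positivity
  -- k²/4 ≥ 2k-1 holds for integers k ≥ 8 but not for 3, 5, 7, which are odd.
  have hmain : √(2 * k - 1) ≤ T ∨ (Odd k ∧ ((k : ℝ) + 1) / 2 ≤ T) ∨ (k : ℝ) / 2 ≤ T ∧ 8 ≤ k := by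
    have h1 := sqrt_le_or_half_card_le ha hb hc (by simp; omega) h
    rw [Fintype.card_fin, ← hT] at h1
    rcases h1 with h1 | h1
    · exact Or.inl h1
    right
    by_cases h8 : 8 ≤ k
    · exact Or.inr ⟨by linarith, h8⟩
    have hodd : Odd k := by
      have : k = 3 ∨ k = 5 ∨ k = 7 := by omega
      rcases this with rfl | rfl | rfl <;> decide
    refine Or.inl ⟨hodd, ?_⟩
    rcases le_or_gt c (1 / 2) with hc2 | hc2
    · have := half_card_succ_le_of_odd ha hb hsymm hdiag (by rwa [Fintype.card_fin]) hc hc2 h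
      rwa [Fintype.card_fin] at this
    · linarith
  have hsqrt : √(2 * k - 1) ≤ T → 2 * (k : ℝ) - 1 ≤ T ^ 2 := fun h => (Real.sqrt_le_left hT0).1 h
  rcases hk with rfl | rfl | hk
  · have hT2 : (4 : ℝ) ≤ T ^ 2 := by
      rcases hmain with h1 | ⟨-, h1⟩ | ⟨-, h1⟩
      · have := hsqrt h1; norm_num at this; linarith
      · norm_num at h1; nlinarith
      · omega
    have : ⌈((3 : ℕ) : ℝ) / 2⌉₊ = 2 := by rw [Nat.ceil_eq_iff] <;> norm_num
    rw [rainbowThreshold, if_pos (by norm_num), this]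
    push_cast; linarith
  · have hT2 : (9 : ℝ) ≤ T ^ 2 := by
      rcases hmain with h1 | ⟨-, h1⟩ | ⟨-, h1⟩
      · have := hsqrt h1; norm_num at this; linarith
      · norm_num at h1; nlinarith
      · omega
    have : ⌈((5 : ℕ) : ℝ) / 2⌉₊ = 3 := by rw [Nat.ceil_eq_iff] <;> norm_num
    rw [rainbowThreshold, if_pos (by norm_num), this]
    push_cast; linarith
  · have hk7 : (7 : ℝ) ≤ k := by exact_mod_cast hk
    have hT2 : 2 * (k : ℝ) - 1 ≤ T ^ 2 := by
      rcases hmain with h1 | ⟨-, h1⟩ | ⟨h1, h8⟩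
      · exact hsqrt h1
      · nlinarith
      · have : (8 : ℝ) ≤ k := by exact_mod_cast h8
        nlinarith
    rw [rainbowThreshold, if_neg (by omega), div_mul_eq_mul_div, one_mul,
      one_le_div (by linarith)]
    exact hT2

/-! ### From graphs to weights. -/

theorem two_mul_ncard_edgeSet {V : Type*} [Fintype V] [DecidableEq V] (G : SimpleGraph V)
    [DecidableRel G.Adj] :
    2 * G.edgeSet.ncard = #(univ.filter fun x : V × V => G.Adj x.1 x.2) := by
  rw [Set.ncard_eq_toFinset_card']
  exact G.two_mul_card_edgeFinset

/-- `W` maximises the number of adjacent ordered pairs minus 2D|W|: deleting a vertex of degree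
below `D` would increase this. -/
theorem exists_core_card_le {V : Type*} [Fintype V] [DecidableEq V] (G : SimpleGraph V)
    [DecidableRel G.Adj] (D : ℕ) :
    ∃ W : Finset V, (∀ v ∈ W, D ≤ #(W.filter (G.Adj v))) ∧
      #(univ.filter fun x : V × V => G.Adj x.1 x.2) ≤
        #((W ×ˢ W).filter fun x => G.Adj x.1 x.2) + 2 * D * Fintype.card V := by
  set N : Finset V → ℕ := fun W => #((W ×ˢ W).filter fun x => G.Adj x.1 x.2) with hN
  obtain ⟨W, -, hW⟩ := exists_max_image (univ : Finset (Finset V))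
    (fun W => (N W : ℤ) - 2 * D * #W) ⟨∅, mem_univ _⟩
  refine ⟨W, fun v hv => ?_, ?_⟩
  · by_contra! hlt
    have h1 : N W ≤ N (W.erase v) + #(W.filter (G.Adj v)) + #(W.filter (G.Adj v)) := by
      have hsub : (W ×ˢ W).filter (fun x => G.Adj x.1 x.2) ⊆
          ((W.erase v ×ˢ W.erase v).filter (fun x => G.Adj x.1 x.2) ∪
            (W.filter (G.Adj v)).image fun u => (v, u)) ∪
              (W.filter (G.Adj v)).image fun u => (u, v) := by
        rintro ⟨x, y⟩ hxy
        simp only [mem_filter, mem_product, mem_union, mem_image, mem_erase, Prod.mk.injEq] at hxy ⊢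
        obtain ⟨⟨hx, hy⟩, hadj⟩ := hxy
        by_cases hxv : x = v
        · exact Or.inl (Or.inr ⟨y, ⟨hy, hxv ▸ hadj⟩, hxv.symm, rfl⟩)
        by_cases hyv : y = v
        · exact Or.inr ⟨x, ⟨hx, (hyv ▸ hadj).symm⟩, rfl, hyv.symm⟩
        exact Or.inl (Or.inl ⟨⟨⟨hxv, hx⟩, hyv, hy⟩, hadj⟩)
      refine (card_le_card hsub).trans ((card_union_le _ _).trans ?_)
      exact add_le_add ((card_union_le _ _).trans (add_le_add le_rfl card_image_le)) card_image_le
    have h2 := hW (W.erase v) (mem_univ _)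
    have h3 : #(W.erase v) + 1 = #W := card_erase_add_one hv
    rw [← h3] at h2
    push_cast at h2
    have h4 : (N W : ℤ) + 2 ≤ N (W.erase v) + 2 * D := by omega
    linarith
  · have h1 := hW univ (mem_univ _)
    have h2 : N univ = #(univ.filter fun x : V × V => G.Adj x.1 x.2) := by
      rw [hN, ← univ_product_univ]
    rw [← h2]
    have h3 : (N univ : ℤ) ≤ N W + 2 * D * Fintype.card V := by
      have : (0 : ℤ) ≤ 2 * D * #W := by positivity
      rw [card_univ] at h1
      linarith
    exact_mod_cast h3

/-- Degree 3 is what the last vertex needs, as it must avoid both `u` and `u'`. -/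
theorem hasRainbowPath_three {V : Type*} [DecidableEq V] {k : ℕ} {G : Fin k → SimpleGraph V}
    {W : Fin k → Finset V} [∀ i, DecidableRel (G i).Adj]
    (hW : ∀ i, ∀ v ∈ W i, 3 ≤ #((W i).filter ((G i).Adj v)))
    {u v : V} {i j l : Fin k} (hadj : (G j).Adj u v) (hu : u ∈ W i) (hv : v ∈ W l)
    (hij : i ≠ j) (hlj : l ≠ j) (hil : i ≠ l) : HasRainbowPath G 3 := by
  obtain ⟨u', hu', hu'2⟩ := exists_mem_notMem_of_card_lt_card
    (s := {v}) (t := (W i).filter ((G i).Adj u)) (by rw [card_singleton]; have := hW i u hu; omega)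
  obtain ⟨v', hv', hv'2⟩ := exists_mem_notMem_of_card_lt_card
    (s := {u, u'}) (t := (W l).filter ((G l).Adj v))
    (by have h1 := hW l v hv; have h2 := card_le_two (a := u) (b := u'); omega)
  have a1 := (mem_filter.1 hu').2
  have a2 := (mem_filter.1 hv').2
  have n1 : u ≠ u' := a1.ne
  have n2 : v ≠ v' := a2.ne
  have n3 : u ≠ v := hadj.ne
  simp only [mem_singleton, mem_insert, not_or] at hu'2 hv'2
  refine ⟨![u', u, v, v'], ![i, j, l], ?_, ?_, ?_⟩
  · intro x y hxy
    fin_cases x <;> fin_cases y <;> simp_all [eq_comm]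
  · intro x y hxy
    fin_cases x <;> fin_cases y <;> simp_all [eq_comm]
  · intro x
    fin_cases x
    · exact a1.symm
    · exact hadj
    · exact a2

/-- Each vertex contributes at most 2; a two-colour label is met once for each order of its colours.
-/
theorem sum_card_color_classes_le {V : Type*} [Fintype V] {k : ℕ} (S : V → Finset (Fin k)) :
    2 * ∑ j, #(univ.filter fun v => S v = {j}) +
      ∑ j, ∑ i, #(univ.filter fun v => j ≠ i ∧ S v = {j, i}) +
        2 * #(univ.filter fun v => 3 ≤ #(S v)) ≤ 2 * Fintype.card V := by
  have hv : ∀ v, 2 * #(univ.filter fun j => S v = {j}) +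
      #(univ.filter fun x : Fin k × Fin k => x.1 ≠ x.2 ∧ S v = {x.1, x.2}) +
        2 * (if 3 ≤ #(S v) then 1 else 0) ≤ 2 := by
    intro v
    have h1 : (univ.filter fun j => S v = {j}).Nonempty → #(S v) = 1 := by
      rintro ⟨j, hj⟩
      rw [(mem_filter.1 hj).2, card_singleton]
    have h2 : (univ.filter fun x : Fin k × Fin k =>
        x.1 ≠ x.2 ∧ S v = {x.1, x.2}).Nonempty → #(S v) = 2 := by
      rintro ⟨x, hx⟩
      rw [(mem_filter.1 hx).2.2, card_pair (mem_filter.1 hx).2.1]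
    have h3 : #(univ.filter fun j => S v = {j}) ≤ #(S v) := card_le_card fun j hj => by
      rw [(mem_filter.1 hj).2]; exact mem_singleton_self j
    have h4 : #(univ.filter fun x : Fin k × Fin k => x.1 ≠ x.2 ∧ S v = {x.1, x.2}) ≤
        #(S v).offDiag := card_le_card fun x hx => by
      obtain ⟨-, hne, hS⟩ := mem_filter.1 hx
      rw [mem_offDiag, hS]
      simp [hne]
    rw [offDiag_card] at h4
    rw [← card_pos] at h1 h2
    split_ifs with h5
    · have : #(univ.filter fun j => S v = {j}) = 0 := by
        by_contra h; have := h1 (Nat.pos_of_ne_zero h); omega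
      have : #(univ.filter fun x : Fin k × Fin k => x.1 ≠ x.2 ∧ S v = {x.1, x.2}) = 0 := by
        by_contra h; have := h2 (Nat.pos_of_ne_zero h); omega
      omega
    · by_cases h : 0 < #(univ.filter fun x : Fin k × Fin k => x.1 ≠ x.2 ∧ S v = {x.1, x.2})
      · have h6 := h2 h
        rw [h6] at h4
        have : #(univ.filter fun j => S v = {j}) = 0 := by
          by_contra h; have := h1 (Nat.pos_of_ne_zero h); omega
        omega
      · by_cases h' : 0 < #(univ.filter fun j => S v = {j})
        · have := h1 h'; omega
        · omega
  have hsum := sum_le_sum fun v (_ : v ∈ univ) => hv v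
  rw [sum_add_distrib, sum_add_distrib, ← mul_sum, ← mul_sum, sum_const, card_univ, smul_eq_mul,
    mul_comm (Fintype.card V), ← card_filter] at hsum
  refine le_trans (le_of_eq ?_) hsum
  congr 2
  · simp_rw [card_filter]
    rw [sum_comm]
  · simp_rw [card_filter, ← univ_product_univ, sum_product]
    exact (sum_congr rfl fun _ _ => sum_comm).trans sum_comm

theorem card_monochromatic_pairs_le {V : Type*} [Fintype V] [DecidableEq V] {k : ℕ}
    (S : V → Finset (Fin k)) (j : Fin k) (E : Finset (V × V))
    (hS : ∀ x ∈ E, j ∈ S x.1 ∧ j ∈ S x.2)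
    (hE : ∀ x ∈ E, S x.1 = {j} ∨ S x.2 = {j} ∨ ∃ i, j ≠ i ∧ S x.1 = {j, i} ∧ S x.2 = {j, i}) :
    #E ≤ #(univ.filter fun v => S v = {j}) ^ 2 + 2 * #(univ.filter fun v => S v = {j}) *
      (∑ i, #(univ.filter fun v => j ≠ i ∧ S v = {j, i}) + #(univ.filter fun v => 3 ≤ #(S v))) +
        ∑ i, #(univ.filter fun v => j ≠ i ∧ S v = {j, i}) ^ 2 := by
  set A := univ.filter fun v => S v = {j} with hA
  set B : Fin k → Finset V := fun i => univ.filter fun v => j ≠ i ∧ S v = {j, i} with hB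
  set C := univ.filter fun v => 3 ≤ #(S v) with hC
  set P := univ.filter fun v => j ∈ S v ∧ S v ≠ {j} with hP
  have hPle : #P ≤ ∑ i, #(B i) + #C := by
    have hsub : P ⊆ univ.biUnion B ∪ C := by
      intro v hv
      obtain ⟨-, hj, hne⟩ := mem_filter.1 hv
      rw [mem_union]
      by_cases h3 : 3 ≤ #(S v)
      · exact Or.inr (mem_filter.2 ⟨mem_univ _, h3⟩)
      left
      have hle : #((S v).erase j) ≤ 1 := by rw [card_erase_of_mem hj]; omega
      have hins : S v = insert j ((S v).erase j) := (insert_erase hj).symm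
      have hne' : (S v).erase j ≠ ∅ := fun h => hne (by rw [hins, h]; rfl)
      obtain ⟨i, hi⟩ := card_eq_one.1
        (le_antisymm hle (card_pos.2 (nonempty_iff_ne_empty.2 hne')))
      refine mem_biUnion.2 ⟨i, mem_univ _, mem_filter.2 ⟨mem_univ _, ?_, ?_⟩⟩
      · rintro rfl
        have : j ∈ (S v).erase j := by rw [hi]; exact mem_singleton_self j
        exact notMem_erase _ _ this
      · rw [hins, hi]
    exact (card_le_card hsub).trans ((card_union_le _ _).trans (add_le_add card_biUnion_le le_rfl))
  have hsub : E ⊆ (A ×ˢ A ∪ A ×ˢ P) ∪ P ×ˢ A ∪ univ.biUnion fun i => B i ×ˢ B i := by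
    rintro ⟨x, y⟩ hxy
    have h1 := hS _ hxy
    have h2 := hE _ hxy
    simp only [mem_union, mem_product, mem_biUnion, hA, hB, hP, mem_filter, mem_univ, true_and]
    simp only at h1 h2
    by_cases hx : S x = {j}
    · by_cases hy : S y = {j}
      · exact Or.inl (Or.inl (Or.inl ⟨hx, hy⟩))
      · exact Or.inl (Or.inl (Or.inr ⟨hx, h1.2, hy⟩))
    · by_cases hy : S y = {j}
      · exact Or.inl (Or.inr ⟨⟨h1.1, hx⟩, hy⟩)
      · obtain ⟨i, hji, hxi, hyi⟩ := (h2.resolve_left hx).resolve_left hy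
        exact Or.inr ⟨i, ⟨hji, hxi⟩, hji, hyi⟩
  have hcard : #E ≤ #A * #A + #A * #P + #P * #A + ∑ i, #(B i) * #(B i) := by
    refine (card_le_card hsub).trans ((card_union_le _ _).trans (add_le_add
      ((card_union_le _ _).trans (add_le_add ((card_union_le _ _).trans ?_) ?_)) ?_))
    · rw [card_product, card_product]
    · rw [card_product]
    · exact card_biUnion_le.trans (sum_le_sum fun i _ => by rw [card_product])
  have h3 := Nat.mul_le_mul_left (#A) hPle
  simp_rw [← pow_two] at hcard
  linarith

/-- By homogeneity, dividing all weights by √d reduces to d = 1. -/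
theorem le_threshold_mul_sq {k : ℕ} (hk : k = 3 ∨ k = 5 ∨ 7 ≤ k)
    {a : Fin k → ℝ} {b : Fin k → Fin k → ℝ} {c d : ℝ}
    (ha : ∀ j, 0 ≤ a j) (hb : ∀ i j, 0 ≤ b i j)
    (hsymm : ∀ i j, b i j = b j i) (hdiag : ∀ j, b j j = 0) (hc : 0 ≤ c) (hd : 0 < d)
    (h : ∀ j, d ≤ a j ^ 2 + 2 * a j * (∑ i, b j i + c) + ∑ i, b j i ^ 2) :
    d ≤ rainbowThreshold k * (∑ j, a j + (∑ j, ∑ i, b j i) / 2 + c) ^ 2 := by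
  set s := √d with hs
  have hs0 : 0 < s := Real.sqrt_pos.2 hd
  have hs2 : s ^ 2 = d := Real.sq_sqrt hd.le
  have hmain := one_le_threshold_mul_sq hk (a := fun j => a j / s) (b := fun j i => b j i / s)
    (c := c / s) (fun j => div_nonneg (ha j) hs0.le) (fun i j => div_nonneg (hb i j) hs0.le)
    (fun i j => by rw [hsymm]) (fun j => by rw [hdiag, zero_div]) (div_nonneg hc hs0.le)
    (fun j => by
      simp_rw [div_pow, ← sum_div]
      have e : a j ^ 2 / s ^ 2 + 2 * (a j / s) * ((∑ i, b j i) / s + c / s) +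
          (∑ i, b j i ^ 2) / s ^ 2 =
          (a j ^ 2 + 2 * a j * (∑ i, b j i + c) + ∑ i, b j i ^ 2) / s ^ 2 := by
        field_simp
      rw [e, hs2, one_le_div hd]
      exact h j)
  simp_rw [← sum_div] at hmain
  have e : rainbowThreshold k *
      ((∑ j, a j) / s + (∑ j, ∑ i, b j i) / s / 2 + c / s) ^ 2 =
      rainbowThreshold k * (∑ j, a j + (∑ j, ∑ i, b j i) / 2 + c) ^ 2 / d := by
    rw [← hs2]; field_simp
  rwa [e, one_le_div hd] at hmain

theorem exists_color_class_sizes {V : Type*} [Fintype V] [DecidableEq V] {k : ℕ}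
    (G : Fin k → SimpleGraph V) [∀ i, DecidableRel (G i).Adj] (hno : ¬ HasRainbowPath G 3) :
    ∃ (a : Fin k → ℕ) (b : Fin k → Fin k → ℕ) (c : ℕ),
      (∀ i j, b i j = b j i) ∧ (∀ j, b j j = 0) ∧
      2 * ∑ j, a j + ∑ j, ∑ i, b j i + 2 * c ≤ 2 * Fintype.card V ∧
      ∀ j, #(univ.filter fun x : V × V => (G j).Adj x.1 x.2) ≤
        a j ^ 2 + 2 * a j * (∑ i, b j i + c) + ∑ i, b j i ^ 2 + 6 * Fintype.card V := by
  choose W hW hWcard using fun i => exists_core_card_le (G i) 3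
  set S : V → Finset (Fin k) := fun v => univ.filter fun i => v ∈ W i with hS
  have hmem : ∀ v i, i ∈ S v ↔ v ∈ W i := fun v i => by simp [hS]
  refine ⟨fun j => #(univ.filter fun v => S v = {j}),
    fun j i => #(univ.filter fun v => j ≠ i ∧ S v = {j, i}),
    #(univ.filter fun v => 3 ≤ #(S v)), fun i j => ?_, fun j => by simp,
    sum_card_color_classes_le S, fun j => (hWcard j).trans (Nat.add_le_add_right ?_ _)⟩
  · exact congrArg card (filter_congr fun v _ => by rw [pair_comm, ne_comm])
  · set E := (W j ×ˢ W j).filter fun x => (G j).Adj x.1 x.2 with hE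
    have h1 : ∀ x ∈ E, j ∈ S x.1 ∧ j ∈ S x.2 := fun x hx => by
      have := mem_product.1 (mem_filter.1 hx).1
      exact ⟨(hmem _ _).2 this.1, (hmem _ _).2 this.2⟩
    exact card_monochromatic_pairs_le S j (E) h1 fun x hx => by
      obtain ⟨m1, m2⟩ := h1 x hx
      have hadj := (mem_filter.1 hx).2
      by_cases hx1 : S x.1 = {j}
      · exact Or.inl hx1
      by_cases hx2 : S x.2 = {j}
      · exact Or.inr (Or.inl hx2)
      have key : ∀ i ∈ S x.1, i ≠ j → ∀ l ∈ S x.2, l ≠ j → i = l := by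
        intro i hi hij l hl hlj
        by_contra hil
        exact hno (hasRainbowPath_three hW hadj ((hmem _ _).1 hi) ((hmem _ _).1 hl) hij hlj hil)
      have hex : ∀ T : Finset (Fin k), j ∈ T → T ≠ {j} → ∃ i ∈ T, i ≠ j := by
        intro T hjT hT
        by_contra! hall
        exact hT (eq_singleton_iff_unique_mem.2 ⟨hjT, hall⟩)
      obtain ⟨i, hi, hij⟩ := hex _ m1 hx1
      obtain ⟨l, hl, hlj⟩ := hex _ m2 hx2
      have hil := key i hi hij l hl hlj
      refine Or.inr (Or.inr ⟨i, hij.symm, ?_, ?_⟩)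
      · ext m
        rw [mem_insert, mem_singleton]
        refine ⟨fun hm => ?_, ?_⟩
        · by_cases hmj : m = j
          · exact Or.inl hmj
          · exact Or.inr ((key m hm hmj l hl hlj).trans hil.symm)
        · rintro (rfl | rfl)
          exacts [m1, hi]
      · ext m
        rw [mem_insert, mem_singleton]
        refine ⟨fun hm => ?_, ?_⟩
        · by_cases hmj : m = j
          · exact Or.inl hmj
          · exact Or.inr (key i hi hij m hm hmj).symm
        · rintro (rfl | rfl)
          · exact m2
          · rw [hil]; exact hl

theorem hasRainbowPath_of_card_le {V : Type*} [Fintype V] {k : ℕ} (hk : k = 3 ∨ k = 5 ∨ 7 ≤ k)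
    {ε : ℝ} (hn : 6 < ε * Fintype.card V) (G : Fin k → SimpleGraph V)
    (hG : ∀ i, (rainbowThreshold k + ε) * ((Fintype.card V : ℝ) ^ 2 / 2) ≤
      ((G i).edgeSet.ncard : ℝ)) : HasRainbowPath G 3 := by
  classical
  by_contra hno
  obtain ⟨a, b, c, hsymm, hdiag, htotal, hcard⟩ := exists_color_class_sizes G hno
  have hf : 0 < rainbowThreshold k := by
    rw [rainbowThreshold]
    have hk3 : (3 : ℝ) ≤ k := by exact_mod_cast (by omega : 3 ≤ k)
    split_ifs
    · have : 0 < ⌈(k : ℝ) / 2⌉₊ := Nat.ceil_pos.2 (by linarith)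
      positivity
    · exact div_pos one_pos (by linarith)
  generalize Fintype.card V = N at *
  have hn0 : (0 : ℝ) < N := by
    rcases (Nat.cast_nonneg N : (0 : ℝ) ≤ N).eq_or_lt with h | h
    · rw [← h] at hn; norm_num at hn
    · exact h
  have hgap : 0 < (ε * N - 6) * N := mul_pos (by linarith) hn0
  -- This `d` is (f+ε)N² minus the 6N ordered pairs lost in passing to a core.
  have hmain := le_threshold_mul_sq hk (a := fun j => (a j : ℝ)) (b := fun i j => (b i j : ℝ))
    (c := c) (d := rainbowThreshold k * (N : ℝ) ^ 2 + (ε * N - 6) * N) (fun j => Nat.cast_nonneg _)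
    (fun i j => Nat.cast_nonneg _) (fun i j => congrArg _ (hsymm i j))
    (fun j => by rw [hdiag, Nat.cast_zero]) (Nat.cast_nonneg _) (by positivity) fun j => by
      have h1 : (#(univ.filter fun x : V × V => (G j).Adj x.1 x.2) : ℝ) ≤
          (a j : ℝ) ^ 2 + 2 * a j * (∑ i, (b j i : ℝ) + c) + ∑ i, (b j i : ℝ) ^ 2 + 6 * N := by
        exact_mod_cast hcard j
      have h2 : 2 * (((G j).edgeSet.ncard : ℕ) : ℝ) =
          #(univ.filter fun x : V × V => (G j).Adj x.1 x.2) := by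
        exact_mod_cast two_mul_ncard_edgeSet (G j)
      have h3 := hG j
      linarith
  have hT0 : (0 : ℝ) ≤ ∑ j, (a j : ℝ) + (∑ j, ∑ i, (b j i : ℝ)) / 2 + c := by positivity
  have htotal' : ∑ j, (a j : ℝ) + (∑ j, ∑ i, (b j i : ℝ)) / 2 + c ≤ N := by
    have : 2 * ∑ j, (a j : ℝ) + ∑ j, ∑ i, (b j i : ℝ) + 2 * c ≤ 2 * N := by exact_mod_cast htotal
    linarith
  have h1 := mul_le_mul_of_nonneg_left (pow_le_pow_left₀ hT0 htotal' 2) hf.le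
  linarith

theorem rainbowThreshold_of_le_six {k : ℕ} (hk : k ≤ 6) :
    rainbowThreshold k = 1 / (((k + 1) / 2 : ℕ) : ℝ) ^ 2 := by
  rw [rainbowThreshold, if_pos hk]
  congr 3
  interval_cases k
  · simp
  all_goals rw [Nat.ceil_eq_iff (by norm_num)]; norm_num

theorem HasRainbowPath.of_comp {V : Type*} {k k' l : ℕ} {G : Fin k → SimpleGraph V}
    {f : Fin k' → Fin k} (hf : Function.Injective f) (h : HasRainbowPath (fun i => G (f i)) l) :
    HasRainbowPath G l := by
  obtain ⟨v, c, hv, hc, hadj⟩ := h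
  exact ⟨v, f ∘ c, hv, hf.comp hc, hadj⟩

theorem two_mul_ncard_edgeSet_le {V : Type*} [Fintype V] (G : SimpleGraph V) :
    2 * (G.edgeSet.ncard : ℝ) ≤ (Fintype.card V : ℝ) ^ 2 := by
  classical
  have h2 : #(univ.filter fun x : V × V => G.Adj x.1 x.2) ≤ Fintype.card V ^ 2 := by
    refine (card_filter_le _ _).trans ?_
    rw [card_univ, Fintype.card_prod, pow_two]
  rw [← two_mul_ncard_edgeSet G] at h2
  exact_mod_cast h2

theorem hasRainbowPath_of_large_card {V : Type*} [Fintype V] {k : ℕ} (hk : 1 ≤ k)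
    {ε : ℝ} (hε : 0 < ε) (hn : 6 < ε * Fintype.card V) (G : Fin k → SimpleGraph V)
    (hG : ∀ i, (rainbowThreshold k + ε) * ((Fintype.card V : ℝ) ^ 2 / 2) ≤
      ((G i).edgeSet.ncard : ℝ)) : HasRainbowPath G 3 := by
  by_cases hgood : k = 3 ∨ k = 5 ∨ 7 ≤ k
  · exact hasRainbowPath_of_card_le hgood hn G hG
  by_cases h2 : k ≤ 2
  · exfalso
    have h1 : rainbowThreshold k = 1 := by
      rw [rainbowThreshold_of_le_six (by omega), (by omega : (k + 1) / 2 = 1)]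
      norm_num
    have h3 := hG ⟨0, hk⟩
    have h4 := two_mul_ncard_edgeSet_le (G ⟨0, hk⟩)
    rw [h1] at h3
    have h5 : 0 < (Fintype.card V : ℝ) := by
      by_contra! h
      nlinarith
    have : 0 < ε * (Fintype.card V : ℝ) ^ 2 := by positivity
    linarith
  -- Since f(4) = f(3) and f(6) = f(5), the last colour can be dropped.
  obtain ⟨k', hk', rfl⟩ : ∃ k', (k' = 3 ∨ k' = 5) ∧ k = k' + 1 := by
    rcases (by omega : k = 4 ∨ k = 6) with rfl | rfl
    exacts [⟨3, by simp⟩, ⟨5, by simp⟩]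
  apply HasRainbowPath.of_comp (Fin.castSucc_injective k')
  refine hasRainbowPath_of_card_le (by omega) hn _ fun i => ?_
  have e : rainbowThreshold k' = rainbowThreshold (k' + 1) := by
    rw [rainbowThreshold_of_le_six (by omega), rainbowThreshold_of_le_six (by omega)]
    rcases hk' with rfl | rfl <;> norm_num
  rw [e]
  exact hG i.castSucc

/-! ### Extremal constructions. -/

theorem exists_balanced_labelling (V : Type*) [Fintype V] {m : ℕ} (hm : 0 < m) :
    ∃ ρ : V → ℕ, (∀ v, ρ v < m) ∧
      ∀ r < m, Fintype.card V / m ≤ #(univ.filter fun v => ρ v = r) := by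
  let e := Fintype.equivFin V
  refine ⟨fun v => (e v : ℕ) % m, fun v => Nat.mod_lt _ hm, fun r hr => ?_⟩
  have hlt : ∀ t ∈ range (Fintype.card V / m), m * t + r < Fintype.card V := by
    intro t ht
    have h1 : t + 1 ≤ Fintype.card V / m := mem_range.1 ht
    have h2 : m * (t + 1) ≤ Fintype.card V :=
      (Nat.mul_le_mul_left m h1).trans (Nat.mul_div_le _ _)
    rw [mul_add] at h2
    omega
  rw [← card_range (Fintype.card V / m), ← card_attach]
  refine card_le_card_of_injOn (fun t => e.symm ⟨m * t.1 + r, hlt t.1 t.2⟩) ?_ ?_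
  · intro t _
    simp [Nat.mod_eq_of_lt hr]
  · intro t _ t' _ h
    have h1 := Fin.mk.inj (e.symm.injective h)
    have h2 : m * t.1 = m * t'.1 := by omega
    exact Subtype.ext (Nat.eq_of_mul_eq_mul_left hm h2)

/-- The vertices labelled `r` form a clique and are joined to all vertices with label at
least `s`. -/
def labelGraph {V : Type*} (ρ : V → ℕ) (r s : ℕ) : SimpleGraph V where
  Adj u v := u ≠ v ∧ (ρ u = r ∧ ρ v = r ∨ ρ u = r ∧ s ≤ ρ v ∨ s ≤ ρ u ∧ ρ v = r)
  symm := ⟨fun _ _ h => ⟨h.1.symm, by tauto⟩⟩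
  loopless := ⟨fun _ h => h.1 rfl⟩

theorem card_labelGraph_edgeSet {V : Type*} [Fintype V] {ρ : V → ℕ} {m r t w : ℕ}
    (hρ : ∀ r < m, w ≤ #(univ.filter fun v => ρ v = r)) (hr : r + t < m) :
    (w : ℝ) * (w - 1) + 2 * w * (t * w) ≤ 2 * ((labelGraph ρ r (m - t)).edgeSet.ncard : ℝ) := by
  classical
  set A := univ.filter fun v => ρ v = r with hA
  set C := univ.filter fun v => m - t ≤ ρ v with hC
  have hAw : w ≤ #A := hρ r (by omega)
  have hCw : t * w ≤ #C := by
    have h1 : (Ico (m - t) m).biUnion (fun r => univ.filter fun v => ρ v = r) ⊆ C := by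
      intro v hv
      obtain ⟨x, hx, hvx⟩ := mem_biUnion.1 hv
      refine mem_filter.2 ⟨mem_univ _, ?_⟩
      rw [(mem_filter.1 hvx).2]
      exact (mem_Ico.1 hx).1
    refine le_trans ?_ (card_le_card h1)
    rw [card_biUnion]
    · have h2 := sum_le_sum fun x (hx : x ∈ Ico (m - t) m) => hρ x (mem_Ico.1 hx).2
      rw [sum_const, Nat.card_Ico, smul_eq_mul, Nat.sub_sub_self (by omega)] at h2
      exact h2
    · intro x _ y _ hxy
      rw [Function.onFun, disjoint_left]
      intro v hx hy
      exact hxy ((mem_filter.1 hx).2.symm.trans (mem_filter.1 hy).2)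
  have hAC : Disjoint A C := by
    rw [disjoint_left]
    intro v h1 h2
    have := (mem_filter.1 h1).2
    have := (mem_filter.1 h2).2
    omega
  have hne : ∀ u ∈ A, ∀ v ∈ C, u ≠ v := fun u hu v hv h => disjoint_left.1 hAC hu (h ▸ hv)
  have hsub : (A.offDiag ∪ A ×ˢ C) ∪ C ×ˢ A ⊆
      univ.filter fun x : V × V => (labelGraph ρ r (m - t)).Adj x.1 x.2 := by
    rintro ⟨x, y⟩ h
    refine mem_filter.2 ⟨mem_univ _, ?_⟩
    rw [mem_union, mem_union, mem_offDiag, mem_product, mem_product] at h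
    rcases h with (⟨h1, h2, h3⟩ | ⟨h1, h2⟩) | ⟨h1, h2⟩
    · exact ⟨h3, Or.inl ⟨(mem_filter.1 h1).2, (mem_filter.1 h2).2⟩⟩
    · exact ⟨hne _ h1 _ h2, Or.inr (Or.inl ⟨(mem_filter.1 h1).2, (mem_filter.1 h2).2⟩)⟩
    · exact ⟨(hne _ h2 _ h1).symm, Or.inr (Or.inr ⟨(mem_filter.1 h1).2, (mem_filter.1 h2).2⟩)⟩
  have hcard := card_le_card hsub
  rw [card_union_of_disjoint, card_union_of_disjoint, card_product, card_product, offDiag_card,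
    ← two_mul_ncard_edgeSet (labelGraph ρ r (m - t))] at hcard
  · have h1 : (#A : ℝ) * #A - #A + #A * #C + #C * #A ≤
        2 * ((labelGraph ρ r (m - t)).edgeSet.ncard : ℝ) := by
      have h2 : #A ≤ #A * #A := Nat.le_mul_self _
      rw [← Nat.cast_mul (#A), ← Nat.cast_sub h2]
      exact_mod_cast hcard
    have h3 : (w : ℝ) ≤ #A := by exact_mod_cast hAw
    have h4 : (t : ℝ) * w ≤ #C := by exact_mod_cast hCw
    have h5 : (w : ℝ) * (t * w) ≤ #A * #C := by gcongr
    have h6 : (w : ℝ) * (w - 1) ≤ #A * #A - #A := by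
      rcases Nat.eq_zero_or_pos w with h0 | h0
      · have : #A ≤ #A * #A := Nat.le_mul_self _
        have : (#A : ℝ) ≤ #A * #A := by exact_mod_cast this
        rw [h0]; push_cast; linarith
      · have : (1 : ℝ) ≤ w := by exact_mod_cast h0
        nlinarith
    linarith
  · rw [disjoint_left]
    rintro ⟨x, y⟩ h1 h2
    exact disjoint_left.1 hAC (mem_offDiag.1 h1).2.1 (mem_product.1 h2).2
  · rw [disjoint_left]
    rintro ⟨x, y⟩ h1 h2
    rcases mem_union.1 h1 with h1 | h1
    · exact disjoint_left.1 hAC (mem_offDiag.1 h1).1 (mem_product.1 h2).1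
    · exact disjoint_left.1 hAC (mem_product.1 h1).1 (mem_product.1 h2).1

/-- With q = n/m, rounding costs at most (4t+3)q, since (q-1)(q-2) + 2t(q-1)² ≥ (2t+1)q² - (4t+3)q.
-/
theorem density_sub_mul_le {n m t : ℕ} {ε : ℝ} (hm : 0 < m) (hn : 4 * t + 3 ≤ ε * n)
    (hmn : 2 * m ≤ n) :
    ((2 * t + 1) / (m : ℝ) ^ 2 - ε) * (n : ℝ) ^ 2 ≤
      ((n / m : ℕ) : ℝ) * ((n / m : ℕ) - 1) + 2 * (n / m : ℕ) * (t * (n / m : ℕ)) := by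
  have hm' : (1 : ℝ) ≤ m := by exact_mod_cast hm
  have ht : (0 : ℝ) ≤ t := t.cast_nonneg
  have hn0 : (0 : ℝ) ≤ n := n.cast_nonneg
  set w : ℝ := ((n / m : ℕ) : ℝ) with hw
  set q : ℝ := (n : ℝ) / m with hq
  have h1 : q - 1 ≤ w := by
    rw [hq, hw, sub_le_iff_le_add, ← Nat.floor_div_eq_div (K := ℝ)]
    exact (Nat.lt_floor_add_one _).le
  have h2 : 2 ≤ q := by
    rw [hq, le_div_iff₀ (by linarith)]
    exact_mod_cast hmn
  have h3 : q ≤ n := div_le_self hn0 hm'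
  have h4 : (2 * t + 1) / (m : ℝ) ^ 2 * (n : ℝ) ^ 2 = (2 * t + 1) * q ^ 2 := by
    rw [hq]; field_simp
  have h5 : (4 * t + 3) * q ≤ ε * (n : ℝ) ^ 2 := by
    calc (4 * t + 3) * q ≤ (4 * t + 3) * n := by gcongr
      _ ≤ ε * n * n := by gcongr
      _ = _ := by ring
  have h6 : (q - 1) * (q - 2) ≤ w * (w - 1) := by nlinarith
  have h7 : (q - 1) ^ 2 ≤ w ^ 2 := by
    have : 0 ≤ q - 1 := by linarith
    gcongr
  have h8 := mul_le_mul_of_nonneg_left h7 ht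
  rw [sub_mul, h4]
  nlinarith

/-- If `g` is injective, the middle edge has an end in the private part of its colour, and no other
colour meets that part. If t = 0, a path stays inside one clique, which carries at most two colours.
-/
theorem exists_no_rainbowPath {V : Type*} [Fintype V] {k m t : ℕ} {ε f : ℝ} {g : Fin k → ℕ}
    (hg : ∀ i, g i + t < m) (hm : 0 < m) (hf : f = (2 * t + 1) / (m : ℝ) ^ 2)
    (hn : 4 * t + 3 ≤ ε * Fintype.card V) (hmn : 2 * m ≤ Fintype.card V)
    (hpath : Function.Injective g ∨ t = 0 ∧ ∀ i j l, g i = g j → g j = g l →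
      i = j ∨ j = l ∨ i = l) :
    ∃ G : Fin k → SimpleGraph V,
      (∀ i, (f - ε) * ((Fintype.card V : ℝ) ^ 2 / 2) ≤ ((G i).edgeSet.ncard : ℝ)) ∧
        ¬ HasRainbowPath G 3 := by
  obtain ⟨ρ, hρm, hρ⟩ := exists_balanced_labelling V hm
  refine ⟨fun i => labelGraph ρ (g i) (m - t), fun i => ?_, ?_⟩
  · have h1 := card_labelGraph_edgeSet hρ (hg i)
    have h2 := density_sub_mul_le hm hn hmn
    rw [hf]
    linarith
  · rintro ⟨v, c, -, hc, hadj⟩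
    have h0 := (hadj 0).2
    have h1 := (hadj 1).2
    have h2 := (hadj 2).2
    have g0 := hg (c 0)
    have g1 := hg (c 1)
    have g2 := hg (c 2)
    have e1 : (Fin.succ 0 : Fin 4) = 1 := rfl
    have e2 : (Fin.succ 1 : Fin 4) = 2 := rfl
    have e3 : (Fin.castSucc 1 : Fin 4) = 1 := rfl
    have e4 : (Fin.castSucc 2 : Fin 4) = 2 := rfl
    rw [e1] at h0
    rw [e2, e3] at h1
    rw [e4] at h2
    have n01 : c 0 ≠ c 1 := hc.ne (by decide)
    have n12 : c 1 ≠ c 2 := hc.ne (by decide)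
    have n02 : c 0 ≠ c 2 := hc.ne (by decide)
    rcases hpath with hinj | ⟨rfl, hthree⟩
    · have m01 : g (c 0) ≠ g (c 1) := hinj.ne n01
      have m12 : g (c 1) ≠ g (c 2) := hinj.ne n12
      omega
    · have r1 := hρm (v 1)
      have r2 := hρm (v 2)
      have := hthree (c 0) (c 1) (c 2) (by omega) (by omega)
      tauto

theorem theorem1 :
    (∀ ε : ℝ, 0 < ε → ∃ n₀ : ℕ, ∀ n : ℕ, n₀ ≤ n → ∀ k : ℕ, 1 ≤ k →
      ∀ (V : Type u) [Fintype V], Fintype.card V = n →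
      ∀ G : Fin k → SimpleGraph V,
        (∀ i : Fin k,
          (rainbowThreshold k + ε) * ((n : ℝ) ^ 2 / 2) ≤ ((G i).edgeSet.ncard : ℝ)) →
        HasRainbowPath G 3) ∧
    (∀ k : ℕ, 1 ≤ k → ∀ ε : ℝ, 0 < ε → ∃ n₀ : ℕ, ∀ n : ℕ, n₀ ≤ n →
      ∀ (V : Type u) [Fintype V], Fintype.card V = n →
      ∃ G : Fin k → SimpleGraph V,
        (∀ i : Fin k,
          (rainbowThreshold k - ε) * ((n : ℝ) ^ 2 / 2) ≤ ((G i).edgeSet.ncard : ℝ)) ∧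
        ¬ HasRainbowPath G 3) := by
  refine ⟨fun ε hε => ?_, fun k hk ε hε => ?_⟩
  · obtain ⟨n₀, hn₀⟩ := exists_nat_gt (6 / ε)
    refine ⟨n₀, ?_⟩
    rintro n hn k hk V _ rfl G hG
    refine hasRainbowPath_of_large_card hk hε ?_ G hG
    rw [div_lt_iff₀' hε] at hn₀
    exact hn₀.trans_le (by gcongr)
  · obtain ⟨n₀, hn₀⟩ := exists_nat_ge ((4 * k + 3) / ε)
    rw [div_le_iff₀' hε] at hn₀
    refine ⟨max n₀ (4 * k), ?_⟩
    rintro n hn V _ rfl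
    have hn1 : 4 * (k : ℝ) + 3 ≤ ε * Fintype.card V :=
      hn₀.trans (by gcongr; exact (le_max_left _ _).trans hn)
    have hn2 : 4 * k ≤ Fintype.card V := (le_max_right _ _).trans hn
    have hk0 : (0 : ℝ) ≤ k := k.cast_nonneg
    by_cases hk6 : k ≤ 6
    · refine exists_no_rainbowPath (m := (k + 1) / 2) (t := 0) (g := fun i => i / 2)
        (fun i => by omega) (by omega) ?_ ?_ (by omega) (Or.inr ⟨rfl, fun i j l h1 h2 => ?_⟩)
      · rw [rainbowThreshold_of_le_six hk6]; simp
      · push_cast; linarith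
      · simp only [Fin.ext_iff]
        omega
    · refine exists_no_rainbowPath (m := 2 * k - 1) (t := k - 1) (g := fun i => i)
        (fun i => by omega) (by omega) ?_ ?_ (by omega) (Or.inl Fin.val_injective)
      · have hk7 : (7 : ℝ) ≤ k := by exact_mod_cast (by omega : 7 ≤ k)
        have h1 : ((2 * k - 1 : ℕ) : ℝ) = 2 * k - 1 := by
          rw [Nat.cast_sub (by omega)]; push_cast; ring
        have h2 : 2 * ((k - 1 : ℕ) : ℝ) + 1 = 2 * k - 1 := by
          rw [Nat.cast_sub (by omega)]; push_cast; ring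
        have h3 : 2 * (k : ℝ) - 1 ≠ 0 := by linarith
        rw [rainbowThreshold, if_neg hk6, h1, h2]
        field_simp
      · rw [Nat.cast_sub hk]; push_cast; linarith
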